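/- Let $k$ be a field and $d \ge 1$ an integer. A standard graded $k$-algebra $R$ is a commutative graded $k$-algebra generated by finitely many forms of degree one; $\mathfrak m$ denotes its ideal generated by the forms of positive degree. For a graded ideal $I \subseteq R$ put $\widetilde I = \bigcup_{t \ge 0} (I : \mathfrak m^t)$; the saturation degree $\operatorname{sdeg} I$ is the least $t \ge 0$ such that $\widetilde I$ and $I$ agree in all degrees $\ge t$, with $\operatorname{sdeg} I = -\infty$ if $\widetilde I = I$. (1) Let $\{b_n\}_{n \ge 1}$ be a convergent sequence of non-negative integers with $b_n - b_{n+1} \le d$ for all $n \ge 1$, and assume $b_1 \ne 0$ if $d = 1$. Then there are a standard graded $k$-algebra $R$ and an ideal $I \subseteq R$ generated by forms of degree $d$ with $\dim R/I \ge 1$ and $I^n \ne 0$ for all $n \ge 1$, such that $\operatorname{sdeg} I^n - dn = b_n$ for all $n \ge 1$. (2) Equivalently, let $f : \mathbb Z_{\ge 1} \to \mathbb Z_{\ge 0}$ be weakly increasing with $f(n) \ge dn$ for all $n \ge 1$, and asymptotically linear with slope $d$, i.e. $f(n) = dn + e$ for some integer $e$ and all sufficiently large $n$; assume $f(1) \ne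 1$ if $d = 1$. Then there are a standard graded $k$-algebra $R$ and an ideal $I \subseteq R$ generated by forms of degree $d$ with $\dim R/I \ge 1$ and $I^n \ne 0$ for all $n \ge 1$, such that $\operatorname{sdeg} I^n = f(n)$ for all $n \ge 1$. -/

import Mathlib

namespace SatDeg

section

variable {k R : Type*} [Field k] [CommRing R] [Algebra k R]

/-- The graded `k`-algebra `R = ⨁ 𝒜 n` is standard graded: it is generated as a `k`-algebra by
finitely many forms of degree one. -/
def IsStandardGraded (𝒜 : ℕ → Submodule k R) [GradedAlgebra 𝒜] : Prop :=
  ∃ s : Finset R, (∀ x ∈ s, x ∈ 𝒜 1) ∧ Algebra.adjoin k (s : Set R) = ⊤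

/-- The ideal `I` is generated by forms of degree `d`. -/
def GeneratedInDegree (𝒜 : ℕ → Submodule k R) (d : ℕ) (I : Ideal R) : Prop :=
  ∃ s : Set R, (∀ x ∈ s, x ∈ 𝒜 d) ∧ I = Ideal.span s

/-- The saturation `⋃ₜ (I : 𝔪ᵗ)`, where `𝔪` is the ideal generated by all forms of positive
degree. -/
def saturation (𝒜 : ℕ → Submodule k R) [GradedAlgebra 𝒜] (I : Ideal R) : Ideal R :=
  ⨆ t : ℕ, I.colon ((HomogeneousIdeal.irrelevant 𝒜).toIdeal ^ t : Ideal R)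

/-- The supremum defining the saturation is the union of the ideals `I : 𝔪ᵗ`. -/
theorem mem_saturation_iff (𝒜 : ℕ → Submodule k R) [GradedAlgebra 𝒜] (I : Ideal R) (x : R) :
    x ∈ saturation 𝒜 I ↔
      ∃ t : ℕ, ∀ y ∈ (HomogeneousIdeal.irrelevant 𝒜).toIdeal ^ t, x * y ∈ I := by
  unfold saturation
  rw [Submodule.mem_iSup_of_directed]
  · simp only [Submodule.mem_colon, SetLike.mem_coe, smul_eq_mul]
  · refine Monotone.directed_le fun a b hab y hy => ?_
    rw [Submodule.mem_colon] at hy ⊢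
    exact fun z hz => hy z (Ideal.pow_le_pow_right hab hz)

/-- The saturation degree: the least `t` such that the saturation of `I` agrees with `I` in all
degrees `≥ t`, with the convention `⊥` (that is, `-∞`) if `I` is saturated. The value is `⊤` if
no such `t` exists; this never happens for a graded ideal of a standard graded algebra. -/
noncomputable def sdeg (𝒜 : ℕ → Submodule k R) [GradedAlgebra 𝒜] (I : Ideal R) : WithBot ℕ∞ :=
  open Classical in
  if saturation 𝒜 I = I then ⊥
  else ((⨅ t ∈ {t : ℕ | ∀ j, t ≤ j → ∀ x ∈ 𝒜 j, x ∈ saturation 𝒜 I ↔ x ∈ I}, (t : ℕ∞) : ℕ∞) :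
    WithBot ℕ∞)

end

universe u

/-- There are a standard graded `k`-algebra `R` and an ideal `I` of `R` generated by forms of
degree `d`, all of whose powers are nonzero, with `dim R/I ≥ 1` (so that `I` is proper), such that
`sdeg Iⁿ = f n` for all `n ≥ 1`. -/
def IsSdegFunction (k : Type u) [Field k] (d : ℕ) (f : ℕ → ℕ) : Prop :=
  ∃ (R : Type u) (_ : CommRing R) (_ : Algebra k R) (𝒜 : ℕ → Submodule k R)
    (_ : GradedAlgebra 𝒜) (I : Ideal R),
    IsStandardGraded 𝒜 ∧ GeneratedInDegree 𝒜 d I ∧ (∀ n : ℕ, 1 ≤ n → I ^ n ≠ ⊥) ∧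
      1 ≤ ringKrullDim (R ⧸ I) ∧
      ∀ n : ℕ, 1 ≤ n → sdeg 𝒜 (I ^ n) = ((f n : ℕ∞) : WithBot ℕ∞)

end SatDeg

/-! Take the monomial algebra on `x`, `z`, `v` and finitely many `u_p` whose basis consists of the
monomials `zᵇ`, `xⁱ vᵇ` and `xⁱ u_pᶜ` with `c ≤ h p i`, each `h p` antitone with values in `ℕ∞`. Let
`I = (xᵈ, zᵈ)`. Since `xz = 0`, `Iⁿ = (xᵃ, zᵃ)` with `a = dn`, so passing to `Iⁿ` only truncates the
exponents of `x` and `z` at `a`.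

Modulo `Iⁿ`, the monomials `xⁱ vᵇ` survive all powers of `v`, and `xⁱ u_pᶜ` survives all powers of
`u_p` when `h p i = ⊤`. Only `zᵇ` with `0 < b < a`, and `xⁱ u_pᶜ` with `i < a`, `c ≥ 1` and `h p i`
finite, can lie in the saturation. Hence `sdeg Iⁿ` is one more than the largest of `a - 1` (if `a ≥
2`) and the numbers `i + h p i` with `i < a` and `1 ≤ h p i < ⊤` (`sdeg_powIdeal`).

The heights are chosen so that `u_p` contributes degree `f (p + 1) - 1` from `n = p + 1` on;
monotonicity of `f` makes the newest contribution dominate. The last `u_N` keeps height `e` forever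
and yields the linear tail, while `z` accounts for the values `f n = dn`. -/

namespace SatDeg

/-! ### Grading on the quotient by a homogeneous ideal. -/

section QuotientGrading

open DirectSum

variable {k A : Type*} [Field k] [CommRing A] [Algebra k A] (𝒜 : ℕ → Submodule k A)

/-- The degree `n` part of a quotient of a graded algebra. -/
def quotientGrading (J : Ideal A) (n : ℕ) : Submodule k (A ⧸ J) :=
  (𝒜 n).map (Ideal.Quotient.mkₐ k J).toLinearMap

theorem mk_mem_quotientGrading {J : Ideal A} {n : ℕ} {a : A} (ha : a ∈ 𝒜 n) :
    Ideal.Quotient.mk J a ∈ quotientGrading 𝒜 J n :=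
  ⟨a, ha, rfl⟩

variable [GradedAlgebra 𝒜]

/-- The decomposition of the class of `a` modulo `J` given by the classes of the homogeneous
components of `a`. -/
noncomputable def quotientComponents (J : Ideal A) : A →+ ⨁ n, quotientGrading 𝒜 J n :=
  (DirectSum.map fun n =>
    ((Ideal.Quotient.mkₐ k J).toLinearMap.submoduleMap (𝒜 n)).toAddMonoidHom).comp
    (decomposeAddEquiv 𝒜).toAddMonoidHom

theorem coe_quotientComponents_apply (J : Ideal A) (a : A) (n : ℕ) :
    (quotientComponents 𝒜 J a n : A ⧸ J) = Ideal.Quotient.mk J (decompose 𝒜 a n) := by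
  exact congrArg Subtype.val (DirectSum.map_apply (fun n =>
    ((Ideal.Quotient.mkₐ k J).toLinearMap.submoduleMap (𝒜 n)).toAddMonoidHom) n (decompose 𝒜 a))

theorem quotientComponents_of_mem (J : Ideal A) {a : A} {n : ℕ} (ha : a ∈ 𝒜 n) :
    quotientComponents 𝒜 J a =
      DirectSum.of (fun n => quotientGrading 𝒜 J n) n ⟨Ideal.Quotient.mk J a,
        mk_mem_quotientGrading 𝒜 ha⟩ := by
  simp only [quotientComponents]
  change DirectSum.map _ (decompose 𝒜 a) = _
  rw [decompose_of_mem _ ha, DirectSum.map_of]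
  rfl

theorem coeAddMonoidHom_quotientComponents (J : Ideal A) (a : A) :
    DirectSum.coeAddMonoidHom (quotientGrading 𝒜 J) (quotientComponents 𝒜 J a) =
      Ideal.Quotient.mk J a := by
  induction a using DirectSum.Decomposition.inductionOn 𝒜 with
  | zero => simp
  | homogeneous a => rw [quotientComponents_of_mem 𝒜 J a.2, DirectSum.coeAddMonoidHom_of]
  | add a b ha hb => rw [map_add, map_add, ha, hb, map_add]

theorem quotientComponents_eq_zero {J : Ideal A} (hJ : J.IsHomogeneous 𝒜) {a : A} (ha : a ∈ J) :
    quotientComponents 𝒜 J a = 0 := by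
  refine DFinsupp.ext fun n => Subtype.ext ?_
  refine (coe_quotientComponents_apply 𝒜 J a n).trans ?_
  exact Ideal.Quotient.eq_zero_iff_mem.mpr (hJ n ha)

/-- The decomposition of an element of a quotient by a homogeneous ideal into its components. -/
noncomputable def quotientDecompose {J : Ideal A} (hJ : J.IsHomogeneous 𝒜) :
    A ⧸ J →+ ⨁ n, quotientGrading 𝒜 J n :=
  QuotientAddGroup.lift (Submodule.toAddSubgroup J) (quotientComponents 𝒜 J)
    fun _ ha => quotientComponents_eq_zero 𝒜 hJ ha

/-- The grading on the quotient of a graded algebra by a homogeneous ideal. -/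
@[reducible]
noncomputable def quotientGradedAlgebra {J : Ideal A} (hJ : J.IsHomogeneous 𝒜) :
    GradedAlgebra (quotientGrading 𝒜 J) where
  one_mem := ⟨1, SetLike.GradedOne.one_mem, map_one (Ideal.Quotient.mk J)⟩
  mul_mem := by
    rintro i j _ _ ⟨a, ha, rfl⟩ ⟨b, hb, rfl⟩
    exact ⟨a * b, SetLike.GradedMul.mul_mem ha hb, map_mul (Ideal.Quotient.mk J) _ _⟩
  decompose' := quotientDecompose 𝒜 hJ
  left_inv x := by
    obtain ⟨a, rfl⟩ := Ideal.Quotient.mk_surjective x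
    exact coeAddMonoidHom_quotientComponents 𝒜 J a
  right_inv x := by
    induction x using DirectSum.induction_on with
    | zero => rw [map_zero, map_zero]
    | of n x =>
      obtain ⟨_, a, ha, rfl⟩ := x
      rw [DirectSum.coeAddMonoidHom_of]
      exact quotientComponents_of_mem 𝒜 J ha
    | add x y hx hy => rw [map_add, map_add, hx, hy]

end QuotientGrading

/-! ### Saturation degree from a top-degree witness. -/

section Sdeg

variable {k R : Type*} [Field k] [CommRing R] [Algebra k R]
  (𝒜 : ℕ → Submodule k R) [GradedAlgebra 𝒜]

/-- `sdeg I = s + 1` if `s` is the top degree in which `I` and its saturation differ. -/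
theorem sdeg_eq_add_one {I : Ideal R} {s : ℕ}
    (hs : ∃ w ∈ 𝒜 s, w ∈ saturation 𝒜 I ∧ w ∉ I)
    (htop : ∀ j, s < j → ∀ x ∈ 𝒜 j, x ∈ saturation 𝒜 I → x ∈ I) :
    sdeg 𝒜 I = (((s + 1 : ℕ) : ℕ∞) : WithBot ℕ∞) := by
  obtain ⟨w, hw, hwsat, hwI⟩ := hs
  unfold sdeg
  have hne : saturation 𝒜 I ≠ I := fun h => hwI (h ▸ hwsat)
  rw [if_neg hne]
  congr 1
  refine le_antisymm (iInf₂_le (s + 1) ?_) ?_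
  · exact fun j hj x hx => ⟨htop j hj x hx, fun h =>
      (mem_saturation_iff 𝒜 I x).mpr ⟨0, fun y _ => I.mul_mem_right y h⟩⟩
  · refine le_iInf₂ fun t ht => Nat.cast_le.mpr ?_
    by_contra hlt
    exact hwI ((ht s (by omega) w hw).mp hwsat)

end Sdeg

/-! ### Ideals spanned by monomials. -/

section MonomialIdeal

open MvPolynomial

variable {σ k : Type*} [Field k]

variable (k) in
/-- The ideal spanned by the monomials with exponent in `U`. -/
noncomputable def monomialIdeal (U : Set (σ →₀ ℕ)) : Ideal (MvPolynomial σ k) :=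
  Ideal.span ((fun m => monomial m 1) '' U)

theorem mem_monomialIdeal {U : Set (σ →₀ ℕ)} (hU : IsUpperSet U) {p : MvPolynomial σ k} :
    p ∈ monomialIdeal k U ↔ ∀ m ∈ p.support, m ∈ U := by
  refine mem_ideal_span_monomial_image.trans (forall₂_congr fun m _ => ?_)
  exact ⟨fun ⟨_, hn, hle⟩ => hU hle hn, fun hm => ⟨m, hm, le_rfl⟩⟩

theorem monomial_mem_monomialIdeal {U : Set (σ →₀ ℕ)} (hU : IsUpperSet U) {m : σ →₀ ℕ} :
    monomial m (1 : k) ∈ monomialIdeal k U ↔ m ∈ U := by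
  classical
  rw [mem_monomialIdeal hU, support_monomial, if_neg one_ne_zero]
  simp

theorem monomialIdeal_mono {U V : Set (σ →₀ ℕ)} (h : U ⊆ V) :
    monomialIdeal k U ≤ monomialIdeal k V :=
  Ideal.span_mono (Set.image_mono h)

attribute [local instance] MvPolynomial.gradedAlgebra

theorem monomialIdeal_isHomogeneous (U : Set (σ →₀ ℕ)) :
    (monomialIdeal k U).IsHomogeneous (homogeneousSubmodule σ k) := by
  refine Ideal.homogeneous_span _ _ ?_
  rintro _ ⟨m, -, rfl⟩
  exact ⟨m.degree, isHomogeneous_monomial 1 rfl⟩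

/-- If `p` is homogeneous of degree `s` and all multiples of degree `> s` of its monomials have
exponents in `U`, then `p` multiplies forms of positive degree into the monomial ideal of `U`. -/
theorem monomial_mul_mem_monomialIdeal {U : Set (σ →₀ ℕ)} (hU : IsUpperSet U) {m : σ →₀ ℕ}
    (hm : ∀ m', m ≤ m' → m.degree < m'.degree → m' ∈ U) {j : ℕ} (hj : 0 < j)
    {p : MvPolynomial σ k} (hp : p.IsHomogeneous j) :
    monomial m 1 * p ∈ monomialIdeal k U := by
  classical
  rw [mem_monomialIdeal hU]
  intro n hn
  obtain ⟨a, ha, b, hb, rfl⟩ := Finset.mem_add.mp (support_mul _ _ hn)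
  have ha' : a = m := by simpa using support_monomial_subset ha
  subst ha'
  have hb' : b.degree = j := by
    by_contra h
    exact (mem_support_iff.mp hb) (hp.coeff_eq_zero h)
  exact hm _ le_self_add (by rw [map_add]; omega)

end MonomialIdeal

end SatDeg

namespace SatDeg

/-! ### The monomial algebra and the powers of its ideal. -/

section Construction

open MvPolynomial

/-- The variables of the monomial algebras realizing saturation degree functions. -/
inductive Generator (ι : Type*)
  | x : Generator ι
  | z : Generator ι
  | v : Generator ι
  | u (p : ι) : Generator ι

open Generator

instance (ι : Type*) [Finite ι] : Finite (Generator ι) := by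
  refine Finite.of_surjective
    (fun g : Option (Option (Option ι)) => match g with
      | none => x
      | some none => z
      | some (some none) => v
      | some (some (some p)) => u p) ?_
  rintro (_ | _ | _ | p)
  · exact ⟨none, rfl⟩
  · exact ⟨some none, rfl⟩
  · exact ⟨some (some none), rfl⟩
  · exact ⟨some (some (some p)), rfl⟩

variable {ι : Type*} (h : ι → ℕ → ℕ∞)

/-- The exponents of `xⁱ vᵇ`, `zᵇ` and of `u_pᵇ xⁱ` for `b ≤ h p i`. -/
def basisExponents : Set (Generator ι →₀ ℕ) :=
  {m | (m z = 0 ∨ ∀ g, g ≠ z → m g = 0) ∧ (m v = 0 ∨ ∀ p, m (u p) = 0) ∧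
    (∀ p q, p ≠ q → m (u p) = 0 ∨ m (u q) = 0) ∧ ∀ p, (m (u p) : ℕ∞) ≤ h p (m x)}

/-- The exponents outside `basisExponents`, together with those of the multiples of `xᵃ` and
`zᵃ`. -/
def powExponents (a : ℕ) : Set (Generator ι →₀ ℕ) :=
  (basisExponents h)ᶜ ∪ {m | a ≤ m x ∨ a ≤ m z}

variable {h}

/-- Antitonicity is what makes the height bounds pass to divisors: lowering the exponent of `x` only
relaxes them. -/
theorem isUpperSet_compl_basisExponents (hh : ∀ p, Antitone (h p)) :
    IsUpperSet (basisExponents h)ᶜ := by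
  rw [isUpperSet_compl]
  rintro m m' hle ⟨h1, h2, h3, h4⟩
  have hz : ∀ g, m g = 0 → m' g = 0 := fun g hg => Nat.le_zero.mp (hg ▸ hle g)
  exact ⟨h1.imp (hz _) fun H g hg => hz _ (H g hg), h2.imp (hz _) fun H p => hz _ (H p),
    fun p q hpq => (h3 p q hpq).imp (hz _) (hz _),
    fun p => (Nat.cast_le.mpr (hle _)).trans ((h4 p).trans (hh p (hle _)))⟩

theorem isUpperSet_powExponents (hh : ∀ p, Antitone (h p)) (a : ℕ) :
    IsUpperSet (powExponents h a) :=
  (isUpperSet_compl_basisExponents hh).union fun _ _ hle hm =>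
    hm.imp (fun H => H.trans (hle _)) fun H => H.trans (hle _)

theorem notMem_powExponents {a : ℕ} {m : Generator ι →₀ ℕ} :
    m ∉ powExponents h a ↔ m ∈ basisExponents h ∧ m x < a ∧ m z < a := by
  simp [powExponents]

theorem eq_single_z {m : Generator ι →₀ ℕ} (hm : m ∈ basisExponents h) (hz : m z ≠ 0) :
    m = Finsupp.single z (m z) := by
  classical
  ext g
  by_cases hg : g = z
  · simp [hg]
  · rw [Finsupp.single_eq_of_ne hg]
    exact (hm.1.resolve_left hz) g hg

theorem eq_single_x_add_single_u {m : Generator ι →₀ ℕ} (hm : m ∈ basisExponents h) {p : ι}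
    (hp : m (u p) ≠ 0) : m = Finsupp.single x (m x) + Finsupp.single (u p) (m (u p)) := by
  classical
  obtain ⟨h1, h2, h3, -⟩ := hm
  ext g
  cases g with
  | x => simp
  | z => simpa using h1.resolve_right fun H => hp (H _ (by simp))
  | v => simpa using h2.resolve_right fun H => hp (H _)
  | u q =>
    by_cases hq : q = p
    · simp [hq]
    · have := (h3 q p hq).resolve_right hp
      simp [this, Ne.symm hq]

theorem single_x_add_single_u_mem {p : ι} {i c : ℕ} (hc : (c : ℕ∞) ≤ h p i) :
    Finsupp.single x i + Finsupp.single (u p) c ∈ basisExponents h := by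
  classical
  refine ⟨Or.inl (by simp), Or.inl (by simp), fun q r hqr => ?_, fun q => ?_⟩
  · by_cases hq : p = q
    · exact Or.inr (by simp [hq, hqr])
    · exact Or.inl (by simp [hq])
  · by_cases hq : p = q
    · subst hq; simpa using hc
    · simp [hq]

theorem single_x_add_single_v_mem (i c : ℕ) :
    Finsupp.single x i + Finsupp.single v c ∈ basisExponents h := by
  classical
  exact ⟨Or.inl (by simp), Or.inr (by simp), by simp, by simp⟩

theorem single_z_mem (c : ℕ) : Finsupp.single z c ∈ basisExponents h := by
  classical
  exact ⟨Or.inr fun g hg => Finsupp.single_eq_of_ne hg, Or.inl (by simp), by simp, by simp⟩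

/-- An exponent of large degree which stays in `powExponents h a` under large multiples of every
variable is in `powExponents h a`. -/
theorem mem_powExponents_of_add_single {a t : ℕ} (hat : a ≤ t)
    (hlt : ∀ p (i c : ℕ), i < a → h p i = c → 1 ≤ c → i + c < t)
    {m : Generator ι →₀ ℕ} (ht : t ≤ m.degree)
    (hm : ∃ s, ∀ r, s ≤ r → ∀ g, m + Finsupp.single g r ∈ powExponents h a) :
    m ∈ powExponents h a := by
  classical
  by_contra hma
  obtain ⟨hmB, hxa, hza⟩ := notMem_powExponents.mp hma
  obtain ⟨s, hs⟩ := hm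
  by_cases hz : m z = 0
  · by_cases hu : ∀ p, m (u p) = 0
    · have hmeq : m = Finsupp.single x (m x) + Finsupp.single v (m v) := by
        ext g
        cases g <;> simp [hz, hu]
      -- Multiplying `xⁱ vᵇ` by powers of `v` never leaves the basis, so such a monomial is not in
      -- the saturation.
      refine notMem_powExponents.mpr ?_ (hs s le_rfl v)
      refine ⟨?_, by simpa using hxa, by simpa using hza⟩
      rw [hmeq, add_assoc, ← Finsupp.single_add]
      exact single_x_add_single_v_mem _ _
    · push Not at hu
      obtain ⟨p, hp⟩ := hu
      have hmeq := eq_single_x_add_single_u hmB hp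
      have hdeg : m.degree = m x + m (u p) := by
        conv_lhs => rw [hmeq]
        rw [map_add, Finsupp.degree_single, Finsupp.degree_single]
      have hle := hmB.2.2.2 p
      cases hc : h p (m x) with
      | top =>
        refine notMem_powExponents.mpr ?_ (hs s le_rfl (u p))
        refine ⟨?_, by simpa using hxa, by simpa using hza⟩
        rw [hmeq, add_assoc, ← Finsupp.single_add]
        refine single_x_add_single_u_mem ?_
        rw [hc]
        exact le_top
      -- At finite height the degree is at most `i + c < t`, against `t ≤ m.degree`.
      | coe c =>
        rw [hc] at hle
        have hle' : m (u p) ≤ c := by exact_mod_cast hle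
        have := hlt p (m x) c hxa hc (by omega)
        omega
  · have hdeg : m.degree = m z := by
      conv_lhs => rw [eq_single_z hmB hz]
      rw [Finsupp.degree_single]
    omega

/-- There is a socle exponent of degree `t - 1` modulo `powExponents h a`. -/
theorem exists_socle_exponent {a t : ℕ}
    (hlt : ∀ p (i c : ℕ), i < a → h p i = c → 1 ≤ c → i + c < t)
    (hex : (t = a ∧ 2 ≤ a) ∨ ∃ p, ∃ i c : ℕ, i < a ∧ h p i = c ∧ 1 ≤ c ∧ i + c + 1 = t)
    (hh : ∀ p, Antitone (h p)) :
    ∃ m : Generator ι →₀ ℕ, m.degree + 1 = t ∧ m ∉ powExponents h a ∧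
      ∀ m', m ≤ m' → m.degree < m'.degree → m' ∈ powExponents h a := by
  classical
  obtain ⟨rfl, ha⟩ | ⟨p, i, c, hi, hc, hc1, hsum⟩ := hex
  · have hdeg : (Finsupp.single z (t - 1) : Generator ι →₀ ℕ).degree = t - 1 :=
      Finsupp.degree_single _ _
    refine ⟨Finsupp.single z (t - 1), by omega, ?_, fun m' hle hlt' => ?_⟩
    · exact notMem_powExponents.mpr ⟨single_z_mem _, by simp; omega, by simp; omega⟩
    · by_contra hm'
      obtain ⟨hB, -, hz⟩ := notMem_powExponents.mp hm'
      have hmz : t - 1 ≤ m' z := by simpa using hle z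
      have hdeg' : m'.degree = m' z := by
        conv_lhs => rw [eq_single_z hB (by omega)]
        rw [Finsupp.degree_single]
      omega
  · have hdeg : (Finsupp.single x i + Finsupp.single (u p) c).degree = i + c := by
      rw [map_add, Finsupp.degree_single, Finsupp.degree_single]
    refine ⟨Finsupp.single x i + Finsupp.single (u p) c, by omega, ?_, fun m' hle hlt' => ?_⟩
    · exact notMem_powExponents.mpr
        ⟨single_x_add_single_u_mem hc.ge, by simpa using hi, by simp; omega⟩
    · by_contra hm'
      obtain ⟨hB, hx, -⟩ := notMem_powExponents.mp hm'
      have hmu : c ≤ m' (u p) := by simpa using hle (u p)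
      have hmx : i ≤ m' x := by simpa using hle x
      have hdeg' : m'.degree = m' x + m' (u p) := by
        conv_lhs => rw [eq_single_x_add_single_u hB (p := p) (by omega)]
        rw [map_add, Finsupp.degree_single, Finsupp.degree_single]
      -- Antitonicity keeps the height finite at the larger exponent of `x`, so the degree bound
      -- `hlt` applies to `m'` as well.
      have hanti : h p (m' x) ≤ c := hc ▸ hh p hmx
      obtain ⟨c', hc'⟩ := ENat.ne_top_iff_exists.mp (ne_top_of_le_ne_top (ENat.natCast_ne_top c) hanti)
      have hle' := hB.2.2.2 p
      rw [← hc'] at hle'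
      have hle'' : m' (u p) ≤ c' := by exact_mod_cast hle'
      have := hlt p (m' x) c' hx hc'.symm (by omega)
      omega

variable (k : Type*) [Field k] (h)

/-- The monomial algebra with basis the monomials with exponents in `basisExponents h`. -/
noncomputable abbrev MonomialAlgebra : Type _ :=
  MvPolynomial (Generator ι) k ⧸ monomialIdeal k (basisExponents h)ᶜ

/-- The grading by degree of the monomial algebra. -/
noncomputable abbrev monomialGrading : ℕ → Submodule k (MonomialAlgebra h k) :=
  quotientGrading (homogeneousSubmodule (Generator ι) k) _

attribute [local instance] MvPolynomial.gradedAlgebra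

noncomputable instance : GradedAlgebra (monomialGrading h k) :=
  quotientGradedAlgebra _ (monomialIdeal_isHomogeneous _)

/-- The class of a variable in the monomial algebra. -/
noncomputable def generator (g : Generator ι) : MonomialAlgebra h k :=
  Ideal.Quotient.mk _ (X g)

/-- The ideal of classes of polynomials with exponents in `powExponents h a`. -/
noncomputable def powIdeal (a : ℕ) : Ideal (MonomialAlgebra h k) :=
  (monomialIdeal k (powExponents h a)).map (Ideal.Quotient.mk _)

theorem generator_mem (g : Generator ι) : generator h k g ∈ monomialGrading h k 1 :=
  mk_mem_quotientGrading _ (isHomogeneous_X k g)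

variable {h k}

theorem mk_mem_powIdeal {a : ℕ} {p : MvPolynomial (Generator ι) k} :
    Ideal.Quotient.mk _ p ∈ powIdeal h k a ↔ p ∈ monomialIdeal k (powExponents h a) :=
  Ideal.mem_quotient_iff_mem (monomialIdeal_mono Set.subset_union_left)

theorem isStandardGraded_monomialGrading [Finite ι] : IsStandardGraded (monomialGrading h k) := by
  refine ⟨(Set.finite_range (generator h k)).toFinset, ?_, ?_⟩
  · simp only [Set.Finite.mem_toFinset, Set.mem_range]
    rintro _ ⟨g, rfl⟩
    exact generator_mem h k g
  · rw [Set.Finite.coe_toFinset, eq_top_iff]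
    rintro y -
    obtain ⟨p, rfl⟩ := Ideal.Quotient.mk_surjective y
    have hp : p ∈ Algebra.adjoin k (Set.range (X : Generator ι → MvPolynomial (Generator ι) k)) :=
      adjoin_range_X (R := k) ▸ Algebra.mem_top
    have := Subalgebra.mem_map.mpr
      ⟨p, hp, (rfl : Ideal.Quotient.mkₐ k (monomialIdeal k (basisExponents h)ᶜ) p = _)⟩
    rw [AlgHom.map_adjoin, ← Set.range_comp] at this
    exact this

/-- All mixed products vanish, so only the pure powers of the two generators remain. -/
theorem span_pair_pow_of_mul_eq_zero {R : Type*} [CommRing R] {a b : R} (hab : a * b = 0) {n : ℕ}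
    (hn : 1 ≤ n) : Ideal.span {a, b} ^ n = Ideal.span {a ^ n, b ^ n} := by
  induction n, hn using Nat.le_induction with
  | base => simp
  | succ n hn ih =>
    obtain ⟨r, rfl⟩ := Nat.exists_eq_add_of_le' hn
    have h1 : a ^ (r + 1) * b = 0 := by rw [pow_succ, mul_assoc, hab, mul_zero]
    have h2 : b ^ (r + 1) * a = 0 := by rw [pow_succ, mul_assoc, mul_comm b a, hab, mul_zero]
    rw [pow_succ, ih, Ideal.span_pair_mul_span_pair, h1, h2, ← pow_succ, ← pow_succ]
    refine le_antisymm (Ideal.span_le.mpr ?_) (Ideal.span_mono ?_)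
    · rintro y (rfl | rfl | rfl | rfl)
      · exact Ideal.subset_span (by simp)
      · exact zero_mem _
      · exact zero_mem _
      · exact Ideal.subset_span (by simp)
    · rintro y (rfl | rfl) <;> simp

theorem generator_x_mul_generator_z (hh : ∀ p, Antitone (h p)) :
    generator h k x * generator h k z = 0 := by
  classical
  rw [generator, generator, ← map_mul, Ideal.Quotient.eq_zero_iff_mem, X, X, monomial_mul, mul_one,
    monomial_mem_monomialIdeal (isUpperSet_compl_basisExponents hh)]
  rintro ⟨h1, -⟩
  rcases h1 with h1 | h1
  · simp at h1
  · simpa using h1 x (by simp)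

theorem span_generator_pow (hh : ∀ p, Antitone (h p)) (a : ℕ) :
    Ideal.span {generator h k x ^ a, generator h k z ^ a} = powIdeal h k a := by
  classical
  refine le_antisymm (Ideal.span_le.mpr ?_) ?_
  · rintro _ (rfl | rfl) <;>
    · rw [generator, ← map_pow, SetLike.mem_coe, mk_mem_powIdeal, X_pow_eq_monomial,
        monomial_mem_monomialIdeal (isUpperSet_powExponents hh a)]
      exact Or.inr (by simp)
  · refine (Ideal.map_span _ _).trans_le (Ideal.span_le.mpr ?_)
    rintro _ ⟨_, ⟨m, hm, rfl⟩, rfl⟩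
    have key : ∀ g, a ≤ m g → generator h k g ^ a ∣ Ideal.Quotient.mk _ (monomial m (1 : k)) := by
      intro g hg
      rw [generator, ← map_pow]
      refine map_dvd _ ?_
      rw [X_pow_eq_monomial]
      exact monomial_dvd_monomial.mpr ⟨Or.inr (Finsupp.single_le_iff.mpr hg), one_dvd _⟩
    rcases hm with hm | hm | hm
    · have : Ideal.Quotient.mk (monomialIdeal k (basisExponents h)ᶜ) (monomial m (1 : k)) = 0 :=
        Ideal.Quotient.eq_zero_iff_mem.mpr (Ideal.subset_span ⟨m, hm, rfl⟩)
      simp [this]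
    · exact Ideal.mem_of_dvd _ (key x hm) (Ideal.subset_span (by simp))
    · exact Ideal.mem_of_dvd _ (key z hm) (Ideal.subset_span (by simp))

/-- The socle monomial of degree `t - 1` gives the lower bound. For the upper bound, membership in a
monomial ideal is tested monomial by monomial, and each monomial of a saturation element is pushed
into the ideal by large powers of every variable. -/
theorem sdeg_powIdeal (hh : ∀ p, Antitone (h p)) {a t : ℕ} (hat : a ≤ t)
    (hlt : ∀ p (i c : ℕ), i < a → h p i = c → 1 ≤ c → i + c < t)
    (hex : (t = a ∧ 2 ≤ a) ∨ ∃ p, ∃ i c : ℕ, i < a ∧ h p i = c ∧ 1 ≤ c ∧ i + c + 1 = t) :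
    sdeg (monomialGrading h k) (powIdeal h k a) = ((t : ℕ∞) : WithBot ℕ∞) := by
  classical
  have hU := isUpperSet_powExponents hh a
  obtain ⟨m, hmt, hm, hsoc⟩ := exists_socle_exponent hlt hex hh
  rw [← hmt]
  refine sdeg_eq_add_one _ ⟨Ideal.Quotient.mk _ (monomial m 1),
    mk_mem_quotientGrading _ (isHomogeneous_monomial 1 rfl), ?_, ?_⟩ ?_
  · rw [mem_saturation_iff]
    refine ⟨1, fun y hy => ?_⟩
    rw [pow_one] at hy
    -- The annihilator of the socle class modulo the ideal is itself an ideal, so forms of positive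
    -- degree suffice.
    suffices H : (HomogeneousIdeal.irrelevant (monomialGrading h k)).toIdeal ≤
        (powIdeal h k a).colon {Ideal.Quotient.mk _ (monomial m (1 : k))} by
      have := Submodule.mem_colon.mp (H hy) _ rfl
      rwa [smul_eq_mul, mul_comm] at this
    rw [HomogeneousIdeal.toIdeal_irrelevant_le]
    rintro j hj _ ⟨p, hp, rfl⟩
    refine Submodule.mem_colon.mpr ?_
    rintro _ rfl
    rw [smul_eq_mul, mul_comm]
    exact mk_mem_powIdeal.mpr (monomial_mul_mem_monomialIdeal hU hsoc hj hp)
  · rw [mk_mem_powIdeal, monomial_mem_monomialIdeal hU]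
    exact hm
  · rintro j hj _ ⟨p, hp, rfl⟩ hsat
    obtain ⟨s, hs⟩ := (mem_saturation_iff _ _ _).mp hsat
    refine mk_mem_powIdeal.mpr ((mem_monomialIdeal hU).mpr fun n hn => ?_)
    have hdeg : n.degree = j := by
      by_contra H
      exact (mem_support_iff.mp hn) (hp.coeff_eq_zero H)
    refine mem_powExponents_of_add_single hat hlt (by omega) ⟨s, fun r hr g => ?_⟩
    have hgen : generator h k g ^ r ∈
        (HomogeneousIdeal.irrelevant (monomialGrading h k)).toIdeal ^ s :=
      Ideal.pow_le_pow_right hr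
        (Ideal.pow_mem_pow (HomogeneousIdeal.mem_irrelevant_of_mem _ one_pos
          (generator_mem h k g)) r)
    have hmem := hs _ hgen
    rw [generator, ← map_pow] at hmem
    have hmem' : p * X g ^ r ∈ monomialIdeal k (powExponents h a) := mk_mem_powIdeal.mp hmem
    refine (mem_monomialIdeal hU).mp hmem' _ ?_
    rw [X_pow_eq_monomial, mem_support_iff, coeff_mul_monomial, mul_one]
    exact mem_support_iff.mp hn

theorem powIdeal_ne_bot (hh : ∀ p, Antitone (h p)) (a : ℕ) : powIdeal h k a ≠ ⊥ := by
  classical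
  intro H
  have hmem : Ideal.Quotient.mk _ (monomial (Finsupp.single x a) (1 : k)) ∈ powIdeal h k a :=
    mk_mem_powIdeal.mpr ((monomial_mem_monomialIdeal (isUpperSet_powExponents hh a)).mpr
      (Or.inr (by simp)))
  rw [H, Ideal.mem_bot, Ideal.Quotient.eq_zero_iff_mem,
    monomial_mem_monomialIdeal (isUpperSet_compl_basisExponents hh)] at hmem
  exact hmem (by simpa using single_x_add_single_v_mem (h := h) a 0)

variable (ι k) in
/-- The evaluation at `v = T` with all other variables set to zero. -/
noncomputable def evalV : MvPolynomial (Generator ι) k →ₐ[k] Polynomial k :=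
  aeval fun g => match g with
    | v => Polynomial.X
    | _ => 0

theorem evalV_eq_zero {a : ℕ} (ha : 1 ≤ a) {p : MvPolynomial (Generator ι) k}
    (hp : p ∈ monomialIdeal k (powExponents h a)) : evalV ι k p = 0 := by
  classical
  refine (Ideal.span_le (I := RingHom.ker (evalV ι k))).mpr ?_ hp
  rintro _ ⟨m, hm, rfl⟩
  change evalV ι k (monomial m 1) = 0
  have hne : ∃ g, g ≠ v ∧ m g ≠ 0 := by
    by_contra! H
    refine notMem_powExponents.mpr ?_ hm
    have hmeq : m = Finsupp.single x 0 + Finsupp.single v (m v) := by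
      ext g
      by_cases hg : g = v
      · simp [hg]
      · simp [H g hg, Finsupp.single_eq_of_ne hg]
    refine ⟨hmeq ▸ single_x_add_single_v_mem _ _, ?_, ?_⟩
    · rw [H x (by simp)]; exact ha
    · rw [H z (by simp)]; exact ha
  obtain ⟨g, hg, hmg⟩ := hne
  rw [evalV, aeval_monomial, Finsupp.prod]
  refine mul_eq_zero_of_right _ (Finset.prod_eq_zero (Finsupp.mem_support_iff.mpr hmg) ?_)
  cases g <;> simp_all

/-- The powers of `v` are untouched by the relations, so the quotient still surjects onto `k[T]`, of
dimension one. -/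
theorem one_le_ringKrullDim_quotient_powIdeal {a : ℕ} (ha : 1 ≤ a) :
    1 ≤ ringKrullDim (MonomialAlgebra h k ⧸ powIdeal h k a) := by
  have h0 : ∀ p ∈ monomialIdeal k (basisExponents h)ᶜ, evalV ι k p = 0 := fun p hp =>
    evalV_eq_zero ha (monomialIdeal_mono Set.subset_union_left hp)
  let φ : MonomialAlgebra h k →+* Polynomial k := Ideal.Quotient.lift _ (evalV ι k).toRingHom h0
  have h1 : ∀ y ∈ powIdeal h k a, φ y = 0 := by
    intro y hy
    obtain ⟨p, rfl⟩ := Ideal.Quotient.mk_surjective y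
    exact evalV_eq_zero ha (mk_mem_powIdeal.mp hy)
  have hsurj : Function.Surjective (evalV ι k) := by
    intro q
    refine ⟨Polynomial.aeval (X v) q, ?_⟩
    rw [← Polynomial.aeval_algHom_apply, evalV, aeval_X, Polynomial.aeval_X_left_apply]
  let ψ : MonomialAlgebra h k ⧸ powIdeal h k a →+* Polynomial k := Ideal.Quotient.lift _ φ h1
  have hψ : Function.Surjective ψ := Ideal.Quotient.lift_surjective_of_surjective _ h1
    (Ideal.Quotient.lift_surjective_of_surjective _ h0 hsurj)
  refine le_trans ?_ (ringKrullDim_le_of_surjective ψ hψ)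
  rw [Polynomial.ringKrullDim_of_isNoetherianRing, ringKrullDim_eq_zero_of_field, zero_add]

end Construction

/-! ### Choice of the heights for a given function. -/

section Realization

/-- The bounds on the exponents realizing a saturation degree function `f` with
`f n = d * n + e` for `n > N`. -/
def heightBound (d e N : ℕ) (f : ℕ → ℕ) (p : Fin (N + 1)) (i : ℕ) : ℕ∞ :=
  -- Infinite height hides `u_p` from the saturation of `Iⁿ` for `n ≤ p`; at `i = dp` the total
  -- degree is tuned to `f (p + 1) - 1`.
  if i < d * p then ⊤
  else if i = d * p then ((f (p + 1) - 1 - d * p : ℕ) : ℕ∞)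
  else if (p : ℕ) = N then (e : ℕ∞) else 0

theorem isSdegFunction_of_eventually_linear (k : Type*) [Field k] {d : ℕ} (hd : 1 ≤ d) {f : ℕ → ℕ}
    {e N : ℕ} (hN : ∀ n, N < n → f n = d * n + e) (hf : ∀ n, 1 ≤ n → d * n ≤ f n)
    (hmono : ∀ n, 1 ≤ n → f n ≤ f (n + 1)) (h1 : d = 1 → f 1 ≠ 1) :
    IsSdegFunction k d f := by
  have hmono' : ∀ m n, 1 ≤ m → m ≤ n → f m ≤ f n := by
    intro m n hm hmn
    induction n, hmn using Nat.le_induction with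
    | base => exact le_rfl
    | succ n hmn ih => exact ih.trans (hmono n (hm.trans hmn))
  set h := heightBound d e N f with hdef
  have hanti : ∀ p, Antitone (h p) := by
    intro p i j hij
    simp only [hdef, heightBound]
    split_ifs with h1 h2 h3 h4 h5 h6 h7 <;> try first | omega | exact le_top | simp
    -- The remaining drop, for `p = N`, is from `f (N + 1) - 1 - dN = d - 1 + e` to `e`.
    have := hN (p + 1) (by omega)
    refine Nat.cast_le.mpr ?_
    rw [this, mul_add]
    omega
  have hlt : ∀ n, 1 ≤ n → ∀ p (i c : ℕ), i < d * n → h p i = c → 1 ≤ c → i + c < f n := by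
    intro n hn p i c hi hc hc1
    simp only [hdef, heightBound] at hc
    split_ifs at hc with h1 h2 h3
    · simp at hc
    · have hpn : (p : ℕ) + 1 ≤ n := by
        subst h2
        exact Nat.lt_of_mul_lt_mul_left hi
      have := hmono' _ _ (by omega) hpn
      have hc' : f (p + 1) - 1 - d * p = c := by exact_mod_cast hc
      omega
    · have hpn : (p : ℕ) < n := Nat.lt_of_mul_lt_mul_left (a := d) (by omega)
      have hc' : e = c := by exact_mod_cast hc
      rw [hN n (by omega)]
      omega
    · have hc' : 0 = c := by exact_mod_cast hc
      omega
  have hex : ∀ n, 1 ≤ n → (f n = d * n ∧ 2 ≤ d * n) ∨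
      ∃ p, ∃ i c : ℕ, i < d * n ∧ h p i = c ∧ 1 ≤ c ∧ i + c + 1 = f n := by
    intro n hn
    by_cases hcase : f n = d * n ∧ 2 ≤ d * n
    · exact Or.inl hcase
    refine Or.inr ?_
    obtain ⟨r, rfl⟩ := Nat.exists_eq_add_of_le' hn
    have hfn := hf _ hn
    have hmul : d * (r + 1) = d * r + d := by ring
    by_cases hr : r ≤ N
    · refine ⟨⟨r, by omega⟩, d * r, f (r + 1) - 1 - d * r, by omega, by simp [hdef, heightBound],
        ?_⟩
      -- This makes the exponent of `u_r` positive. It fails only for `d = 1`, `r = 0`, `f 1 = 1`,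
      -- which `h1` excludes, or when `f n = dn ≥ 2`, which `z` handles.
      have : d * r + 2 ≤ f (r + 1) := by
        rcases Nat.eq_zero_or_pos r with rfl | hr0
        · simp only [mul_zero, zero_add, mul_one] at *
          by_contra!
          exact h1 (by omega) (by omega)
        · have : d ≤ d * r := Nat.le_mul_of_pos_right d hr0
          omega
      omega
    · have hlin := hN (r + 1) (by omega)
      have hdr : d * N + d ≤ d * r := by
        rw [← Nat.mul_succ]
        exact Nat.mul_le_mul_left d (by omega)
      -- The witness is `u_Nᵉ` times the highest surviving power of `x`; here `e ≥ 1` because `f n ≠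
      -- dn`.
      refine ⟨⟨N, by omega⟩, d * r + d - 1, e, by omega, ?_, by omega, by omega⟩
      simp only [hdef, heightBound]
      rw [if_neg (by omega), if_neg (by omega), if_pos trivial]
  have hpow : ∀ n, 1 ≤ n →
      powIdeal h k d ^ n = powIdeal h k (d * n) := by
    intro n hn
    have hz : generator h k Generator.x ^ d * generator h k Generator.z ^ d = 0 := by
      rw [← mul_pow, generator_x_mul_generator_z hanti, zero_pow (by omega)]
    rw [← span_generator_pow hanti, span_pair_pow_of_mul_eq_zero hz hn, ← pow_mul, ← pow_mul,
      span_generator_pow hanti]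
  refine ⟨MonomialAlgebra h k, inferInstance, inferInstance, monomialGrading h k, inferInstance,
    powIdeal h k d, isStandardGraded_monomialGrading, ?_, fun n hn => ?_,
    one_le_ringKrullDim_quotient_powIdeal hd, fun n hn => ?_⟩
  · refine ⟨_, ?_, (span_generator_pow hanti d).symm⟩
    have hgen : ∀ g, generator h k g ^ d ∈ monomialGrading h k d := fun g => by
      simpa using SetLike.pow_mem_graded d (generator_mem h k g)
    rintro _ (rfl | rfl)
    · exact hgen _
    · exact hgen _
  · rw [hpow n hn]
    exact powIdeal_ne_bot hanti _
  · rw [hpow n hn]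
    exact sdeg_powIdeal hanti (hf n hn) (hlt n hn) (hex n hn)

/-- Weakly increasing functions `f` with `f n ≥ d * n` that are eventually linear of slope `d` are
saturation degree functions. -/
theorem isSdegFunction_of_monotone (k : Type*) [Field k] {d : ℕ} (hd : 1 ≤ d) {f : ℕ → ℕ}
    (hlin : ∃ e : ℤ, ∀ᶠ n : ℕ in Filter.atTop, (f n : ℤ) = (d : ℤ) * (n : ℤ) + e)
    (hf : ∀ n : ℕ, 1 ≤ n → d * n ≤ f n) (hmono : ∀ n : ℕ, 1 ≤ n → f n ≤ f (n + 1))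
    (h1 : d = 1 → f 1 ≠ 1) : IsSdegFunction k d f := by
  obtain ⟨e, he⟩ := hlin
  obtain ⟨N, hN⟩ := Filter.eventually_atTop.mp he
  -- The bound `dn ≤ f n` at one large `n` forces the intercept to be a natural number.
  have he0 : 0 ≤ e := by
    have h2 := hN (N + 1) (by omega)
    have h3 : ((d * (N + 1) : ℕ) : ℤ) ≤ f (N + 1) := by exact_mod_cast hf (N + 1) (by omega)
    push_cast at h2 h3
    linarith
  lift e to ℕ using he0
  exact isSdegFunction_of_eventually_linear k hd
    (fun n hn => by exact_mod_cast hN n hn.le) hf hmono h1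

end Realization

end SatDeg

/-- Part (1) reduces to part (2) with `f n = dn + b n`: a convergent sequence of naturals is
eventually constant, and `b n - b (n + 1) ≤ d` says exactly that `f` is weakly increasing. -/
theorem theorem4p9 (k : Type*) [Field k] (d : ℕ) (hd : 1 ≤ d) :
    (∀ b : ℕ → ℕ, (∃ l : ℕ, Filter.Tendsto b Filter.atTop (nhds l)) →
      (∀ n : ℕ, 1 ≤ n → (b n : ℤ) - (b (n + 1) : ℤ) ≤ (d : ℤ)) →
      (d = 1 → b 1 ≠ 0) →
      SatDeg.IsSdegFunction k d (fun n => d * n + b n)) ∧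
    (∀ f : ℕ → ℕ, (∃ e : ℤ, ∀ᶠ n : ℕ in Filter.atTop, (f n : ℤ) = (d : ℤ) * (n : ℤ) + e) →
      (∀ n : ℕ, 1 ≤ n → d * n ≤ f n) →
      (∀ n : ℕ, 1 ≤ n → f n ≤ f (n + 1)) →
      (d = 1 → f 1 ≠ 1) →
      SatDeg.IsSdegFunction k d f) := by
  refine ⟨?_, fun f hlin hf hmono h1 => SatDeg.isSdegFunction_of_monotone k hd hlin hf hmono h1⟩
  rintro b ⟨l, hl⟩ hb h1
  refine SatDeg.isSdegFunction_of_monotone k hd ⟨l, ?_⟩ (fun n _ => Nat.le_add_right _ _)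
    (fun n hn => ?_) fun hd1 => ?_
  · rw [nhds_discrete, Filter.tendsto_pure] at hl
    filter_upwards [hl] with n hn
    push_cast
    rw [hn]
  · have := hb n hn
    simp only [mul_add, mul_one]
    omega
  · have := h1 hd1
    simp only [mul_one]
    omega
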